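/- **Conventions.** A graph on a set $X$ is a symmetric set $G\subset X\times X$ disjoint from the diagonal $\Delta_X$. Let $d_G$ be its path metric (with value $\infty$ between different components) and $E_G=\{(x,y): d_G(x,y)<\infty\}$. If $X$ is a standard Borel space and $G$ is a Borel subset of $X\times X$, then $G$ is called a Borel graph. Graphs $G,G'$ on $X$ are *Lipschitz equivalent* if for some integer $l\ge 1$ we have $d_G(x,y)\le l$ for all $(x,y)\in G'$ and $d_{G'}(x,y)\le l$ for all $(x,y)\in G$. For graphs $T,H$ on $X$, we write $G'=T\ast H$ if $G'=T\cup H$ and $E_T,E_H$ are *freely intersecting*, i.e. $x_0\neq x_{2n}$ whenever $n\ge 1$ and $x_0,\dots,x_{2n}\in X$ satisfy $(x_{2i},x_{2i+1})\in E_T\setminus\Delta_X$ and $(x_{2i+1},x_{2i+2})\in E_H\setminus\Delta_X$ for all $0\le i\le n-1$. A *cut* of $G$ is a non-empty proper subset $C$ of an $E_G$-class $\omega$ for which $\partial_{\mathrm{oe}}^G C=\{(x,y)\in G: x\in C,\ y\in\omega\setminus C\}$ is finite; its inner vertex boundary is $\partial_{\mathrm{iv}}^G C=\{x\in C:\ (x,y)\in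 G\text{ for some }y\in\omega\setminus C\}$. A cut is determined by $\partial_{\mathrm{oe}}^G C$, and a set $\mathcal C$ of cuts is *Borel* if $\{\partial_{\mathrm{oe}}^G C: C\in\mathcal C\}$ is a Borel set in the space of finite subsets of $X\times X$ (that is, for every $n$ the set of $n$-tuples enumerating one of its members is Borel in $(X\times X)^n$). A *Borel treeset* of $G$ is a Borel set $\mathcal C$ of cuts such that for each $E_G$-class $\omega$ the family $\mathcal C_\omega=\{C\in\mathcal C: C\subset\omega\}$ is a treeset on $\omega$: writing $\overline C=\omega\setminus C$, for all $C,D\in\mathcal C_\omega$ one of $C\cap D,\ C\cap\overline D,\ \overline C\cap D,\ \overline C\cap\overline D$ is empty; $\overline C\in\mathcal C_\omega$ for all $C\in\mathcal C_\omega$; and $\{C\in\mathcal C_\omega: x\in C,\ y\notin C\}$ is finite for all $x,y\in\omega$. The set $\mathcal C$ has *uniformly bounded boundaries* if the $d_G$-diameters of the sets $\partial_{\mathrm{iv}}^G C$, $C\in\mathcal C$, are bounded by a common finite constant. **Proposition.** Let $X$ be a standard Borel space, $G$ a Borel graph on $X$ with uniformly bounded degrees, and $\mathcal C$ a Borel treeset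 of $G$ with uniformly bounded boundaries such that for every $(x,y)\in G$, $$|\{C\in\mathcal C: x\in C,\ y\notin C\}|\le 1.$$ Then there exists a Borel graph $G'$ on $X$, Lipschitz equivalent to $G$, such that: 1. $G'=T\ast H$ for some Borel graphs $T,H\subset G'$ on $X$; 2. $T$ is acyclic; 3. for every $C\in\mathcal C$ and every $E_H$-class $\omega$, the set $C\cap\omega$ is not a cut of $H$. -/

import Mathlib

/-! Graphs on a set `X` are `SimpleGraph X`.  The path metric `d_G` is `SimpleGraph.edist` (with values
in `ℕ∞`), the relation `E_G` is `SimpleGraph.Reachable`, and the `E_G`-classes are the supports of the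
connected components. -/

namespace BorelGraph

variable {X : Type*}

/-- A graph on a measurable space is Borel if its edge set is a measurable subset of `X × X`. -/
def IsBorel [MeasurableSpace X] (G : SimpleGraph X) : Prop :=
  MeasurableSet {p : X × X | G.Adj p.1 p.2}

/-- Uniformly bounded degrees: the numbers of neighbours are bounded by one natural number. -/
def HasBoundedDegrees (G : SimpleGraph X) : Prop :=
  ∃ d : ℕ, ∀ x : X, {y : X | G.Adj x y}.encard ≤ d

/-- Lipschitz equivalence: for some `l ≥ 1`, every edge of either graph joins two points at distance
at most `l` in the other one. -/
def LipschitzEquivalent (G H : SimpleGraph X) : Prop :=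
  ∃ l : ℕ, 1 ≤ l ∧ (∀ x y, H.Adj x y → G.edist x y ≤ l) ∧ (∀ x y, G.Adj x y → H.edist x y ≤ l)

/-- `E_G` and `E_H` are freely intersecting: no alternating sequence `x 0, x 1, …, x (2 * n)` with
`n ≥ 1` and non-trivial steps is closed. Only the first `2 * n + 1` values of `x` matter. -/
def FreelyIntersecting (G H : SimpleGraph X) : Prop :=
  ∀ (n : ℕ) (x : ℕ → X), 1 ≤ n →
    (∀ i < n,
      (G.Reachable (x (2 * i)) (x (2 * i + 1)) ∧ x (2 * i) ≠ x (2 * i + 1)) ∧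
      (H.Reachable (x (2 * i + 1)) (x (2 * i + 2)) ∧ x (2 * i + 1) ≠ x (2 * i + 2))) →
    x 0 ≠ x (2 * n)

/-- `K = G * H`. -/
def IsFreeProduct (K G H : SimpleGraph X) : Prop :=
  K = G ⊔ H ∧ FreelyIntersecting G H

/-- The inner vertex boundary. For a subset `C` of an `E_G`-class, a neighbour of a point of `C` lies
in the same class, so that it lies in the complement of `C` in the class iff it is not in `C`. -/
def innerVertexBoundary (G : SimpleGraph X) (C : Set X) : Set X :=
  {x | x ∈ C ∧ ∃ y, y ∉ C ∧ G.Adj x y}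

/-- The outward edge boundary: the edges `(x, y)` with `x ∈ C` and `y` in the complement of `C` in its
class. -/
def outerEdgeBoundary (G : SimpleGraph X) (C : Set X) : Set (X × X) :=
  {p | p.1 ∈ C ∧ p.2 ∉ C ∧ G.Adj p.1 p.2}

/-- A cut is a non-empty proper subset of an `E_G`-class with finite edge boundary. -/
def IsCut (G : SimpleGraph X) (C : Set X) : Prop :=
  ∃ ω : G.ConnectedComponent, C ⊆ ω.supp ∧ C.Nonempty ∧ (ω.supp \ C).Nonempty ∧
    (outerEdgeBoundary G C).Finite

/-- The Borel structure of the space of finite subsets of `Y`: a family of finite sets is Borel iff,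
for every `n`, the set of all `n`-tuples that enumerate one of its members is Borel in `Y ^ n`. -/
noncomputable abbrev finsetBorelSpace (Y : Type*) [MeasurableSpace Y] : MeasurableSpace (Finset Y) :=
  by classical exact
    MeasurableSpace.map (fun t : (Σ n : ℕ, (Fin n → Y)) => Finset.univ.image t.2) inferInstance

/-- A Borel cutset: a set of cuts which is Borel when a cut is identified with the finite set of its
outward boundary edges (which determines it). -/
structure IsBorelCutset [MeasurableSpace X] (G : SimpleGraph X) (𝒞 : Set (Set X)) : Prop where
  isCut : ∀ C ∈ 𝒞, IsCut G C
  measurable : @MeasurableSet (Finset (X × X)) (finsetBorelSpace (X × X))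
    {s : Finset (X × X) | ∃ C ∈ 𝒞, (s : Set (X × X)) = outerEdgeBoundary G C}

/-- A treeset on the set `ω`; complements are taken in `ω`. -/
structure IsTreesetOn (ω : Set X) (𝒟 : Set (Set X)) : Prop where
  subset : ∀ C ∈ 𝒟, C ⊆ ω
  nonempty : ∀ C ∈ 𝒟, C.Nonempty
  proper : ∀ C ∈ 𝒟, C ≠ ω
  nested : ∀ C ∈ 𝒟, ∀ D ∈ 𝒟,
    C ∩ D = ∅ ∨ C ∩ (ω \ D) = ∅ ∨ (ω \ C) ∩ D = ∅ ∨ (ω \ C) ∩ (ω \ D) = ∅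
  compl_mem : ∀ C ∈ 𝒟, ω \ C ∈ 𝒟
  finitely_separating : ∀ x ∈ ω, ∀ y ∈ ω, {C | C ∈ 𝒟 ∧ x ∈ C ∧ y ∉ C}.Finite

/-- A Borel treeset: a Borel cutset whose members inside each `E_G`-class form a treeset on it. -/
structure IsBorelTreeset [MeasurableSpace X] (G : SimpleGraph X) (𝒞 : Set (Set X)) : Prop
    extends IsBorelCutset G 𝒞 where
  isTreesetOn : ∀ ω : G.ConnectedComponent, IsTreesetOn ω.supp {C | C ∈ 𝒞 ∧ C ⊆ ω.supp}

/-- Uniformly bounded boundaries: the `d_G`-diameters of the inner vertex boundaries of the members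
are bounded by one natural number. -/
def HasUniformlyBoundedBoundaries (G : SimpleGraph X) (𝒞 : Set (Set X)) : Prop :=
  ∃ r : ℕ, ∀ C ∈ 𝒞, ∀ x ∈ innerVertexBoundary G C, ∀ y ∈ innerVertexBoundary G C,
    G.edist x y ≤ r

/-- `𝒞|_H`: the intersections of the members of `𝒞` with the `E_H`-classes. -/
def restrictFamily (𝒞 : Set (Set X)) (H : SimpleGraph X) : Set (Set X) :=
  {D | ∃ C ∈ 𝒞, ∃ ω : H.ConnectedComponent, D = C ∩ ω.supp}

/-- `𝒟^*`: the members of `𝒟` that are cuts of `H`. -/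
def cutsIn (H : SimpleGraph X) (𝒟 : Set (Set X)) : Set (Set X) :=
  {D | D ∈ 𝒟 ∧ IsCut H D}

end BorelGraph

/-! A treeset is like the set of oriented edges of a tree. By the hypothesis on edges, an edge of
`G` crosses at most one complementary pair of members, so it either stays at one vertex of that tree
or runs along one of its edges. `T` (`treePart`) keeps a single edge of `G` across each pair; `H`
(`blockPart`) keeps the uncrossed edges and makes each inner vertex boundary a clique.

By nestedness, no member separates two points of such a clique
(`IsBorelTreeset.mem_of_mem_innerVertexBoundary`), hence none separates two `H`-connected points,
and no cut of `H` is left. Acyclicity and free intersection are the same argument: moving along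
`T`-edges without backtracking, with `H`-connected moves in between, one enters a decreasing
sequence of members (`EntersWithin.step`) and so cannot return to the start, which lies outside the
first of them.

For Lipschitz equivalence, a crossed edge is replaced by a clique step, the `T`-edge across the same
pair, and another clique step; conversely, clique edges are short in `G` because boundaries are
uniformly bounded.

For Borelness, quantifiers over members become projections from finite enumerations of boundaries.
One boundary edge with its orientation determines the member, so these projections have fibres of
bounded size and preserve Borel sets (`measurableSet_image_of_encard_fiber_le`). -/

namespace BorelGraph

open MeasureTheory

/-! ### Images under bounded-to-one Borel maps -/

/-- A Borel map with fibres of bounded finite size maps Borel sets to Borel sets. -/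
theorem measurableSet_image_of_encard_fiber_le {Y Z : Type*} [MeasurableSpace Y]
    [StandardBorelSpace Y] [MeasurableSpace Z] [StandardBorelSpace Z] {f : Z → Y}
    (hf : Measurable f) (d : ℕ) :
    ∀ B : Set Z, MeasurableSet B → (∀ y, {z | z ∈ B ∧ f z = y}.encard ≤ d) →
      MeasurableSet (f '' B) := by
  induction d with
  | zero =>
    intro B _ hd
    have hB : B = ∅ := by
      refine Set.eq_empty_of_forall_notMem fun z hz => ?_
      have h := hd (f z)
      rw [Nat.cast_zero, nonpos_iff_eq_zero, Set.encard_eq_zero] at h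
      exact Set.notMem_empty z (h ▸ (⟨hz, rfl⟩ : z ∈ {w | w ∈ B ∧ f w = f z}))
    simp [hB]
  | succ d ih =>
    intro B hB hd
    have hφ := measurableEmbedding_embeddingReal Z
    set φ := embeddingReal Z
    -- `K` holds the `φ`-increasing enumerations of fibres with exactly `d + 1` points in `B`. Each
    -- such fibre has only one, so the set `P` of their values is an injective Borel image; off `P`
    -- the fibres have at most `d` points and induction applies.
    let K : Set (Fin (d + 1) → Z) :=
      {z | (∀ i, z i ∈ B) ∧ (∀ i, f (z i) = f (z 0)) ∧ StrictMono (fun i => φ (z i))}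
    have hK : MeasurableSet K := by
      have h1 : MeasurableSet {z : Fin (d + 1) → Z | ∀ i, z i ∈ B} := by
        rw [Set.ofPred_forall]
        exact MeasurableSet.iInter fun i => measurable_pi_apply i hB
      have h2 : MeasurableSet {z : Fin (d + 1) → Z | ∀ i, f (z i) = f (z 0)} := by
        rw [Set.ofPred_forall]
        exact MeasurableSet.iInter fun i => measurableSet_eq_fun
          (hf.comp (measurable_pi_apply i)) (hf.comp (measurable_pi_apply 0))
      have h3 : MeasurableSet {z : Fin (d + 1) → Z | StrictMono (fun i => φ (z i))} := by
        simp only [StrictMono, Set.ofPred_forall]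
        exact MeasurableSet.iInter fun i => MeasurableSet.iInter fun j =>
          MeasurableSet.iInter fun _ => measurableSet_lt
            (hφ.measurable.comp (measurable_pi_apply i))
            (hφ.measurable.comp (measurable_pi_apply j))
      exact h1.inter (h2.inter h3)
    have hinj : Set.InjOn (fun z : Fin (d + 1) → Z => f (z 0)) K := by
      have key : ∀ z ∈ K, Set.range z = {w | w ∈ B ∧ f w = f (z 0)} := by
        intro z hz
        have hzi : Function.Injective z := fun i j hij =>
          hz.2.2.injective (congrArg φ hij)
        have hfin : {w | w ∈ B ∧ f w = f (z 0)}.Finite :=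
          Set.finite_of_encard_le_coe (hd (f (z 0)))
        refine hfin.eq_of_subset_of_encard_le' ?_ ?_
        · rintro _ ⟨i, rfl⟩
          exact ⟨hz.1 i, hz.2.1 i⟩
        · rw [← Set.image_univ, hzi.encard_image]
          simpa using hd (f (z 0))
      intro z hz w hw hzw
      have hr : Set.range z = Set.range w := by
        rw [key z hz, key w hw]
        simp only at hzw
        rw [hzw]
      have hr' : Set.range (fun i => φ (z i)) = Set.range (fun i => φ (w i)) := by
        have := congrArg (Set.image φ) hr
        rwa [← Set.range_comp, ← Set.range_comp] at this
      have := (StrictMono.range_inj hz.2.2 hw.2.2).1 hr'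
      funext i
      exact hφ.injective (congrFun this i)
    have hP : MeasurableSet ((fun z : Fin (d + 1) → Z => f (z 0)) '' K) :=
      hK.image_of_measurable_injOn (hf.comp (measurable_pi_apply 0)) hinj
    set P := (fun z : Fin (d + 1) → Z => f (z 0)) '' K
    have hB' := ih (B \ f ⁻¹' P) (hB.diff (hf hP)) (by
      intro y
      by_contra hlt
      obtain ⟨t, ht, htc⟩ :=
        Set.exists_subset_encard_eq (Order.add_one_le_of_lt (not_le.1 hlt))
      have htf : t.Finite := Set.finite_of_encard_eq_coe (k := d + 1) (by simpa using htc)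
      have hsc : (φ '' t).encard = d + 1 := by rw [hφ.injective.encard_image, htc]
      have hcard : (htf.image φ).toFinset.card = d + 1 := by
        have := (htf.image φ).encard_eq_coe_toFinset_card
        rw [hsc] at this
        exact_mod_cast this.symm
      let e := (htf.image φ).toFinset.orderEmbOfFin hcard
      have he : ∀ i, ∃ z ∈ t, φ z = e i := fun i => by
        exact (htf.image φ).mem_toFinset.1 ((htf.image φ).toFinset.orderEmbOfFin_mem hcard i)
      choose z hz hze using he
      have hy : ∀ i, f (z i) = y := fun i => (ht (hz i)).2
      refine (ht (hz 0)).1.2 ⟨z, ⟨fun i => (ht (hz i)).1.1, fun i => ?_, ?_⟩, rfl⟩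
      · rw [hy, hy]
      · simp only [hze]
        exact e.strictMono)
    have heq : f '' B = P ∪ f '' (B \ f ⁻¹' P) := by
      ext y
      constructor
      · rintro ⟨z, hz, rfl⟩
        by_cases h : f z ∈ P
        · exact Or.inl h
        · exact Or.inr ⟨z, ⟨hz, h⟩, rfl⟩
      · rintro (⟨z, hz, rfl⟩ | ⟨z, hz, rfl⟩)
        · exact ⟨z 0, hz.1 0, rfl⟩
        · exact ⟨z, hz.1, rfl⟩
    rw [heq]
    exact hP.union hB'

/-- A measurable real weight on pairs that determines the unordered pair. -/
noncomputable def pairKey {X : Type*} [MeasurableSpace X] [StandardBorelSpace X] (p : X × X) : ℝ :=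
  embeddingReal (ℝ × ℝ) (min (embeddingReal X p.1) (embeddingReal X p.2),
    max (embeddingReal X p.1) (embeddingReal X p.2))

section PairKey

variable {X : Type*} [MeasurableSpace X] [StandardBorelSpace X]

theorem measurable_pairKey : Measurable (pairKey : X × X → ℝ) := by
  have h1 : Measurable fun p : X × X => embeddingReal X p.1 :=
    (measurableEmbedding_embeddingReal X).measurable.comp measurable_fst
  have h2 : Measurable fun p : X × X => embeddingReal X p.2 :=
    (measurableEmbedding_embeddingReal X).measurable.comp measurable_snd
  exact (measurableEmbedding_embeddingReal (ℝ × ℝ)).measurable.comp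
    ((h1.min h2).prodMk (h1.max h2))

theorem pairKey_swap (x y : X) : pairKey (x, y) = pairKey (y, x) := by
  simp [pairKey, min_comm, max_comm]

theorem eq_or_eq_of_pairKey_eq {a b x y : X} (h : pairKey (a, b) = pairKey (x, y)) :
    (a = x ∧ b = y) ∨ (a = y ∧ b = x) := by
  have h' := (measurableEmbedding_embeddingReal (ℝ × ℝ)).injective h
  have hi := (measurableEmbedding_embeddingReal X).injective
  simp only [Prod.mk.injEq] at h'
  obtain ⟨h1, h2⟩ := h'
  simp only [← hi.eq_iff]
  rcases le_total (embeddingReal X a) (embeddingReal X b) with hab | hab <;>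
  rcases le_total (embeddingReal X x) (embeddingReal X y) with hxy | hxy <;>
  simp_all

end PairKey

/-! ### Nested cuts -/

section Cuts

variable {X : Type*} {G : SimpleGraph X} {𝒞 : Set (Set X)}

theorem eq_of_separates (hsep : ∀ x y : X, G.Adj x y → {C | C ∈ 𝒞 ∧ x ∈ C ∧ y ∉ C}.encard ≤ 1)
    {x y : X} (hxy : G.Adj x y) {C D : Set X} (hC : C ∈ 𝒞) (hD : D ∈ 𝒞) (hxC : x ∈ C)
    (hyC : y ∉ C) (hxD : x ∈ D) (hyD : y ∉ D) : C = D :=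
  Set.encard_le_one_iff.1 (hsep x y hxy) C D ⟨hC, hxC, hyC⟩ ⟨hD, hxD, hyD⟩

variable [MeasurableSpace X]

theorem IsBorelTreeset.exists_compl_mem (h𝒞 : IsBorelTreeset G 𝒞) {C : Set X} (hC : C ∈ 𝒞) :
    ∃ ω : G.ConnectedComponent, C ⊆ ω.supp ∧ ω.supp \ C ∈ 𝒞 := by
  obtain ⟨ω, hω, -⟩ := h𝒞.isCut C hC
  exact ⟨ω, hω, ((h𝒞.isTreesetOn ω).compl_mem C ⟨hC, hω⟩).1⟩

theorem IsBorelTreeset.reachable (h𝒞 : IsBorelTreeset G 𝒞) {C : Set X} (hC : C ∈ 𝒞) {x y : X}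
    (hx : x ∈ C) (hy : y ∈ C) : G.Reachable x y := by
  obtain ⟨ω, hω, -⟩ := h𝒞.isCut C hC
  have h1 := hω hx
  have h2 := hω hy
  rw [SimpleGraph.ConnectedComponent.mem_supp_iff] at h1 h2
  exact SimpleGraph.ConnectedComponent.eq.1 (h1.trans h2.symm)

theorem IsBorelTreeset.exists_compl (h𝒞 : IsBorelTreeset G 𝒞) {C : Set X} (hC : C ∈ 𝒞) {x : X}
    (hx : x ∈ C) : ∃ D ∈ 𝒞, ∀ z, G.Reachable x z → (z ∈ D ↔ z ∉ C) := by
  obtain ⟨ω, hω, hD⟩ := h𝒞.exists_compl_mem hC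
  refine ⟨_, hD, fun z hz => ?_⟩
  have hzω : z ∈ ω.supp := by
    have h1 := hω hx
    rw [SimpleGraph.ConnectedComponent.mem_supp_iff] at h1 ⊢
    rw [← h1]
    exact SimpleGraph.ConnectedComponent.eq.2 hz.symm
  simp [hzω]

/-- Two members of a treeset cannot have all four corners non-empty. -/
theorem IsBorelTreeset.false_of_corners (h𝒞 : IsBorelTreeset G 𝒞) {C D : Set X} (hC : C ∈ 𝒞)
    (hD : D ∈ 𝒞) {a b c d : X} (haC : a ∈ C) (haD : a ∈ D) (hbC : b ∈ C) (hbD : b ∉ D)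
    (hcC : c ∉ C) (hcD : c ∈ D) (hdC : d ∉ C) (hdD : d ∉ D) (had : G.Reachable a d) : False := by
  have hmem : ∀ z, G.Reachable a z → z ∈ (G.connectedComponentMk a).supp := fun z hz =>
    SimpleGraph.ConnectedComponent.eq.2 hz.symm
  have hb := hmem b (h𝒞.reachable hC haC hbC)
  have hc := hmem c (h𝒞.reachable hD haD hcD)
  rcases (h𝒞.isTreesetOn (G.connectedComponentMk a)).nested
    C ⟨hC, fun z hz => hmem z (h𝒞.reachable hC haC hz)⟩
    D ⟨hD, fun z hz => hmem z (h𝒞.reachable hD haD hz)⟩ with h | h | h | h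
  · exact Set.notMem_empty a (h ▸ ⟨haC, haD⟩)
  · exact Set.notMem_empty b (h ▸ ⟨hbC, hb, hbD⟩)
  · exact Set.notMem_empty c (h ▸ ⟨⟨hc, hcC⟩, hcD⟩)
  · exact Set.notMem_empty d (h ▸ ⟨⟨hmem d had, hdC⟩, hmem d had, hdD⟩)

/-- Members of a treeset crossed by one edge in opposite directions are complementary. -/
theorem IsBorelTreeset.mem_iff_notMem_of_opposite (h𝒞 : IsBorelTreeset G 𝒞)
    (hsep : ∀ x y : X, G.Adj x y → {C | C ∈ 𝒞 ∧ x ∈ C ∧ y ∉ C}.encard ≤ 1)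
    {x y : X} (hxy : G.Adj x y) {C D : Set X} (hC : C ∈ 𝒞) (hD : D ∈ 𝒞) (hxC : x ∈ C)
    (hyC : y ∉ C) (hxD : x ∉ D) (hyD : y ∈ D) {z : X} (hz : G.Reachable x z) :
    z ∈ C ↔ z ∉ D := by
  obtain ⟨E, hE, hED⟩ := h𝒞.exists_compl hD hyD
  have hCE : C = E := eq_of_separates hsep hxy hC hE hxC hyC
    ((hED x hxy.reachable.symm).2 hxD) (fun h => (hED y .rfl).1 h hyD)
  rw [hCE]
  exact hED z (hxy.reachable.symm.trans hz)

/-- Points of the inner vertex boundary of one member are not separated by another member. -/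
theorem IsBorelTreeset.mem_of_mem_innerVertexBoundary (h𝒞 : IsBorelTreeset G 𝒞)
    (hsep : ∀ x y : X, G.Adj x y → {C | C ∈ 𝒞 ∧ x ∈ C ∧ y ∉ C}.encard ≤ 1)
    {C D : Set X} (hC : C ∈ 𝒞) (hD : D ∈ 𝒞) {x y : X} (hx : x ∈ innerVertexBoundary G C)
    (hy : y ∈ innerVertexBoundary G C) (hxD : x ∈ D) : y ∈ D := by
  by_contra hyD
  obtain ⟨hxC, u, huC, hxu⟩ := hx
  obtain ⟨hyC, v, hvC, hyv⟩ := hy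
  -- If `D` separates `x` from `y`, then `u ∈ D`, since an edge leaving both `C` and `D` gives `C =
  -- D`; and `v ∉ D`, since otherwise `C` and `D` are complementary. So `x`, `y`, `u`, `v` fill all
  -- four corners.
  have huD : u ∈ D := by
    by_contra huD
    have := eq_of_separates hsep hxu hC hD hxC huC hxD huD
    exact hyD (this ▸ hyC)
  have hvD : v ∉ D := fun hvD =>
    (h𝒞.mem_iff_notMem_of_opposite hsep hyv hC hD hyC hvC hyD hvD
      (h𝒞.reachable hC hyC hxC)).1 hxC hxD
  exact h𝒞.false_of_corners hC hD hxC hxD hyC hyD huC huD hvC hvD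
    ((h𝒞.reachable hC hxC hyC).trans hyv.reachable)

end Cuts

/-! ### The tree part and the block part -/

section Parts

variable {X : Type*} [MeasurableSpace X] {G : SimpleGraph X} {𝒞 : Set (Set X)}

/-- One edge of `G` across each pair of complementary members of the treeset, chosen with minimal
key. -/
def treePart [StandardBorelSpace X] (h𝒞 : IsBorelTreeset G 𝒞) : SimpleGraph X where
  Adj x y := ∃ C ∈ 𝒞, (x, y) ∈ outerEdgeBoundary G C ∧
    ∀ p ∈ outerEdgeBoundary G C, pairKey (x, y) ≤ pairKey p
  symm := ⟨by
    rintro x y ⟨C, hC, ⟨hx, hy, hxy⟩, hmin⟩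
    -- The complement has the same boundary edges reversed, and `pairKey` ignores orientation.
    obtain ⟨D, hD, hDC⟩ := h𝒞.exists_compl hC hx
    refine ⟨D, hD, ⟨(hDC y hxy.reachable).2 hy, fun h => (hDC x .rfl).1 h hx, hxy.symm⟩, ?_⟩
    rintro ⟨u, v⟩ ⟨hu, hv, huv⟩
    have hxu : G.Reachable x u := hxy.reachable.trans
      (h𝒞.reachable hD ((hDC y hxy.reachable).2 hy) hu)
    have hvC : v ∈ C := by
      by_contra hvC
      exact hv ((hDC v (hxu.trans huv.reachable)).2 hvC)
    rw [pairKey_swap y x, pairKey_swap u v]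
    exact hmin (v, u) ⟨hvC, (hDC u hxu).1 hu, huv.symm⟩⟩
  loopless := ⟨by
    rintro x ⟨C, _, ⟨hx, hx', _⟩, _⟩
    exact hx' hx⟩

/-- The edges of `G` that no member of the family crosses, together with all pairs of points in the
inner vertex boundary of one member. -/
def blockPart (G : SimpleGraph X) (𝒞 : Set (Set X)) : SimpleGraph X where
  Adj x y := x ≠ y ∧ ((G.Adj x y ∧ ∀ C ∈ 𝒞, x ∈ C ↔ y ∈ C) ∨
    ∃ C ∈ 𝒞, x ∈ innerVertexBoundary G C ∧ y ∈ innerVertexBoundary G C)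
  symm := ⟨by
    rintro x y ⟨hne, ⟨h, h'⟩ | ⟨C, hC, hx, hy⟩⟩
    · exact ⟨hne.symm, Or.inl ⟨h.symm, fun C hC => (h' C hC).symm⟩⟩
    · exact ⟨hne.symm, Or.inr ⟨C, hC, hy, hx⟩⟩⟩
  loopless := ⟨fun _ h => h.1 rfl⟩

theorem mem_iff_of_blockPart_reachable (h𝒞 : IsBorelTreeset G 𝒞)
    (hsep : ∀ x y : X, G.Adj x y → {C | C ∈ 𝒞 ∧ x ∈ C ∧ y ∉ C}.encard ≤ 1)
    {x y : X} (hxy : (blockPart G 𝒞).Reachable x y) {D : Set X} (hD : D ∈ 𝒞) :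
    x ∈ D ↔ y ∈ D := by
  obtain ⟨p⟩ := hxy
  induction p with
  | nil => rfl
  | cons h _ ih =>
    rw [← ih]
    obtain ⟨-, ⟨-, h⟩ | ⟨C, hC, hu, hv⟩⟩ := h
    · exact h D hD
    · exact ⟨h𝒞.mem_of_mem_innerVertexBoundary hsep hC hD hu hv,
        h𝒞.mem_of_mem_innerVertexBoundary hsep hC hD hv hu⟩

theorem cutsIn_blockPart (h𝒞 : IsBorelTreeset G 𝒞)
    (hsep : ∀ x y : X, G.Adj x y → {C | C ∈ 𝒞 ∧ x ∈ C ∧ y ∉ C}.encard ≤ 1) :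
    cutsIn (blockPart G 𝒞) (restrictFamily 𝒞 (blockPart G 𝒞)) = ∅ := by
  refine Set.eq_empty_of_forall_notMem ?_
  rintro _ ⟨⟨C, hC, ω, rfl⟩, ω', hsub, ⟨x, hx⟩, ⟨y, hy, hyC⟩, -⟩
  have hxω := hx.2
  have hxω' := hsub hx
  rw [SimpleGraph.ConnectedComponent.mem_supp_iff] at hxω hxω' hy
  have hxy : (blockPart G 𝒞).Reachable x y :=
    SimpleGraph.ConnectedComponent.eq.1 (hxω'.trans hy.symm)
  refine hyC ⟨(mem_iff_of_blockPart_reachable h𝒞 hsep hxy hC).1 hx.1, ?_⟩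
  rw [SimpleGraph.ConnectedComponent.mem_supp_iff, hy, ← hxω', hxω]

variable [StandardBorelSpace X]

theorem treePart_le (h𝒞 : IsBorelTreeset G 𝒞) : treePart h𝒞 ≤ G :=
  fun _ _ ⟨_, _, h, _⟩ => h.2.2

/-- Every member of the treeset crossed by an edge is crossed by an edge of the tree part. -/
theorem exists_treePart_adj (h𝒞 : IsBorelTreeset G 𝒞) {C : Set X} (hC : C ∈ 𝒞) {x y : X}
    (h : (x, y) ∈ outerEdgeBoundary G C) :
    ∃ a b, (treePart h𝒞).Adj a b ∧ (a, b) ∈ outerEdgeBoundary G C := by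
  obtain ⟨-, -, -, -, hfin⟩ := h𝒞.isCut C hC
  obtain ⟨⟨a, b⟩, hab, hmin⟩ := Set.exists_min_image _ pairKey hfin ⟨_, h⟩
  exact ⟨a, b, ⟨C, hC, hab, hmin⟩, hab⟩

/-- Each member of the treeset is crossed by at most one edge of the tree part. -/
theorem treePart_adj_unique (h𝒞 : IsBorelTreeset G 𝒞)
    (hsep : ∀ x y : X, G.Adj x y → {C | C ∈ 𝒞 ∧ x ∈ C ∧ y ∉ C}.encard ≤ 1)
    {C : Set X} (hC : C ∈ 𝒞) {a b x y : X} (hab : (treePart h𝒞).Adj a b) (haC : a ∈ C)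
    (hbC : b ∉ C) (hxy : (treePart h𝒞).Adj x y) (hxC : x ∈ C) (hyC : y ∉ C) :
    a = x ∧ b = y := by
  have key : ∀ {u v : X}, (treePart h𝒞).Adj u v → u ∈ C → v ∉ C →
      ∀ p ∈ outerEdgeBoundary G C, pairKey (u, v) ≤ pairKey p := by
    rintro u v ⟨D, hD, ⟨huD, hvD, huv⟩, hmin⟩ hu hv
    rwa [eq_of_separates hsep huv hC hD hu hv huD hvD]
  rcases eq_or_eq_of_pairKey_eq (le_antisymm
    (key hab haC hbC (x, y) ⟨hxC, hyC, treePart_le h𝒞 hxy⟩)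
    (key hxy hxC hyC (a, b) ⟨haC, hbC, treePart_le h𝒞 hab⟩)) with h | ⟨rfl, rfl⟩
  · exact h
  · exact absurd haC hyC

/-! ### Acyclicity and free intersection -/

/-- The directed edge `(a, b)` of the tree part enters a member of the treeset which is contained in
`C`. -/
def EntersWithin (h𝒞 : IsBorelTreeset G 𝒞) (C : Set X) (a b : X) : Prop :=
  (treePart h𝒞).Adj a b ∧ ∃ D ∈ 𝒞, a ∉ D ∧ b ∈ D ∧ D ⊆ C

theorem exists_entersWithin (h𝒞 : IsBorelTreeset G 𝒞) {a b : X} (h : (treePart h𝒞).Adj a b) :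
    ∃ C, a ∉ C ∧ EntersWithin h𝒞 C a b := by
  obtain ⟨C, hC, ⟨hb, ha, -⟩, -⟩ := h.symm
  exact ⟨C, ha, h, C, hC, ha, hb, subset_rfl⟩

/-- Following an edge of the tree part by another one, other than its reverse, that starts in the
same block. -/
theorem EntersWithin.step {h𝒞 : IsBorelTreeset G 𝒞}
    (hsep : ∀ x y : X, G.Adj x y → {C | C ∈ 𝒞 ∧ x ∈ C ∧ y ∉ C}.encard ≤ 1)
    {C : Set X} {a b c d : X} (h : EntersWithin h𝒞 C a b)
    (hbc : (blockPart G 𝒞).Reachable b c) (hcd : (treePart h𝒞).Adj c d)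
    (hne : ¬ (b = c ∧ a = d)) : EntersWithin h𝒞 C c d := by
  obtain ⟨hab, D, hD, haD, hbD, hDC⟩ := h
  obtain ⟨E, hE, ⟨hdE, hcE, hdc⟩, -⟩ := hcd.symm
  have hab' := treePart_le h𝒞 hab
  have hcD : c ∈ D := (mem_iff_of_blockPart_reachable h𝒞 hsep hbc hD).1 hbD
  have hbE : b ∉ E := fun h => hcE ((mem_iff_of_blockPart_reachable h𝒞 hsep hbc hE).1 h)
  have hdD : d ∈ D := by
    by_contra hdD
    exact hne (treePart_adj_unique h𝒞 hsep hD hab.symm hbD haD hcd hcD hdD)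
  -- Otherwise the edge `ab` crosses `D` and `E` in opposite directions, making them complementary,
  -- although both contain `d`.
  have haE : a ∉ E := by
    intro haE
    exact (h𝒞.mem_iff_notMem_of_opposite hsep hab' hE hD haE hbE haD hbD
      (hab'.reachable.trans (h𝒞.reachable hD hbD hdD))).1 hdE hdD
  -- Three corners are occupied, by `d`, `c` and `a`; nestedness leaves `E \ D` empty.
  refine ⟨hcd, E, hE, hcE, hdE, fun z hz => hDC ?_⟩
  by_contra hzD
  exact h𝒞.false_of_corners hD hE hdD hdE hcD hcE hzD hz haD haE
    ((h𝒞.reachable hD hdD hbD).trans hab'.symm.reachable)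

/-- A trail never repeats an edge, so consecutive edges do not backtrack, and `EntersWithin.step`
applies with a trivial block move. -/
theorem EntersWithin.trail {h𝒞 : IsBorelTreeset G 𝒞}
    (hsep : ∀ x y : X, G.Adj x y → {C | C ∈ 𝒞 ∧ x ∈ C ∧ y ∉ C}.encard ≤ 1)
    {C : Set X} {b v : X} (q : (treePart h𝒞).Walk b v) :
    ∀ {a : X} (h : EntersWithin h𝒞 C a b), (SimpleGraph.Walk.cons h.1 q).IsTrail →
      ∃ a', EntersWithin h𝒞 C a' v := by
  induction q with
  | nil => exact fun h _ => ⟨_, h⟩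
  | @cons b d v hbd q ih =>
    intro a h hq
    rw [SimpleGraph.Walk.isTrail_cons] at hq
    refine ih (h.step hsep .rfl hbd ?_) hq.1
    rintro ⟨-, rfl⟩
    apply hq.2
    simp [Sym2.eq_swap]

theorem treePart_isAcyclic (h𝒞 : IsBorelTreeset G 𝒞)
    (hsep : ∀ x y : X, G.Adj x y → {C | C ∈ 𝒞 ∧ x ∈ C ∧ y ∉ C}.encard ≤ 1) :
    (treePart h𝒞).IsAcyclic := by
  intro a p hp
  cases p with
  | nil => exact hp.ne_nil rfl
  | cons h q =>
    obtain ⟨C, haC, hC⟩ := exists_entersWithin h𝒞 h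
    obtain ⟨_, _, D, _, _, haD, hDC⟩ := hC.trail hsep q hp.isTrail
    exact haC (hDC haD)

theorem freelyIntersecting_treePart_blockPart (h𝒞 : IsBorelTreeset G 𝒞)
    (hsep : ∀ x y : X, G.Adj x y → {C | C ∈ 𝒞 ∧ x ∈ C ∧ y ∉ C}.encard ≤ 1) :
    FreelyIntersecting (treePart h𝒞) (blockPart G 𝒞) := by
  intro n x hn hx
  have path : ∀ {u v : X}, (treePart h𝒞).Reachable u v → u ≠ v →
      ∃ (w : X) (h : (treePart h𝒞).Adj u w) (q : (treePart h𝒞).Walk w v),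
        (SimpleGraph.Walk.cons h q).IsTrail := by
    intro u v huv hne
    obtain ⟨p, hp⟩ := huv.exists_isPath
    cases p with
    | nil => exact absurd rfl hne
    | cons h q => exact ⟨_, h, q, hp.isTrail⟩
  have start : ∃ C, x 0 ∉ C ∧ ∃ a, EntersWithin h𝒞 C a (x 1) := by
    obtain ⟨w, h, q, hq⟩ := path (hx 0 hn).1.1 (hx 0 hn).1.2
    obtain ⟨C, haC, hC⟩ := exists_entersWithin h𝒞 h
    exact ⟨C, haC, hC.trail hsep q hq⟩
  obtain ⟨C, hxC, hC⟩ := start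
  have main : ∀ i < n, ∃ a, EntersWithin h𝒞 C a (x (2 * i + 1)) := by
    intro i
    induction i with
    | zero => exact fun _ => hC
    | succ i ih =>
      intro hi
      obtain ⟨a, ha⟩ := ih (by omega)
      obtain ⟨hH, hHne⟩ := (hx i (by omega)).2
      obtain ⟨w, h, q, hq⟩ := path (hx (i + 1) hi).1.1 (hx (i + 1) hi).1.2
      exact (ha.step hsep hH h fun h' => hHne h'.1).trail hsep q hq
  -- The last `H`-move cannot leave `D ⊆ C`, so the final point is in `C`, whereas `x 0` is not.
  obtain ⟨_, _, D, hD, _, hbD, hDC⟩ := main (n - 1) (by omega)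
  have hlast := (hx (n - 1) (by omega)).2.1
  rw [show 2 * (n - 1) + 2 = 2 * n by omega] at hlast
  intro h
  rw [h] at hxC
  exact hxC (hDC ((mem_iff_of_blockPart_reachable h𝒞 hsep hlast hD).1 hbD))

/-! ### Lipschitz equivalence -/

theorem lipschitzEquivalent_treePart_sup_blockPart (h𝒞 : IsBorelTreeset G 𝒞)
    (hbdd : HasUniformlyBoundedBoundaries G 𝒞) :
    LipschitzEquivalent G (treePart h𝒞 ⊔ blockPart G 𝒞) := by
  obtain ⟨r, hr⟩ := hbdd
  set K := treePart h𝒞 ⊔ blockPart G 𝒞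
  have hone : ∀ {F : SimpleGraph X} {x y : X}, F.Adj x y → F.edist x y ≤ 1 :=
    fun h => (SimpleGraph.edist_eq_one_iff_adj.2 h).le
  -- `r` covers the clique edges, `3` the detour that replaces a crossed edge.
  refine ⟨r + 3, by omega, ?_, ?_⟩
  · intro x y h
    have h1 : (1 : ℕ∞) ≤ ((r + 3 : ℕ) : ℕ∞) := by exact_mod_cast (by omega : 1 ≤ r + 3)
    rcases h with h | ⟨-, ⟨h, -⟩ | ⟨C, hC, hx, hy⟩⟩
    · exact (hone (treePart_le h𝒞 h)).trans h1
    · exact (hone h).trans h1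
    · exact (hr C hC x hx y hy).trans (by exact_mod_cast (by omega : r ≤ r + 3))
  · have hK : ∀ {C : Set X} {x y : X}, C ∈ 𝒞 → x ∈ innerVertexBoundary G C →
        y ∈ innerVertexBoundary G C → K.edist x y ≤ 1 := by
      intro C x y hC hx hy
      rcases eq_or_ne x y with rfl | hne
      · simp
      · exact hone (Or.inr ⟨hne, Or.inr ⟨C, hC, hx, hy⟩⟩)
    have cross : ∀ {C : Set X} {x y : X}, C ∈ 𝒞 → x ∈ C → y ∉ C → G.Adj x y →
        K.edist x y ≤ 3 := by
      intro C x y hC hx hy hxy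
      obtain ⟨a, b, hab, ha, hb, habG⟩ := exists_treePart_adj h𝒞 hC ⟨hx, hy, hxy⟩
      obtain ⟨D, hD, hDC⟩ := h𝒞.exists_compl hC hx
      have hxa := h𝒞.reachable hC hx ha
      have h1 : K.edist x a ≤ 1 := hK hC ⟨hx, y, hy, hxy⟩ ⟨ha, b, hb, habG⟩
      have h2 : K.edist a b ≤ 1 := hone (Or.inl hab)
      have h3 : K.edist b y ≤ 1 := hK hD
        ⟨(hDC b (hxa.trans habG.reachable)).2 hb, a, fun h => (hDC a hxa).1 h ha, habG.symm⟩
        ⟨(hDC y hxy.reachable).2 hy, x, fun h => (hDC x .rfl).1 h hx, hxy.symm⟩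
      calc K.edist x y ≤ K.edist x a + (K.edist a b + K.edist b y) :=
            SimpleGraph.edist_triangle.trans (add_le_add le_rfl SimpleGraph.edist_triangle)
        _ ≤ 1 + (1 + 1) := add_le_add h1 (add_le_add h2 h3)
        _ = 3 := by norm_num
    intro x y hxy
    have h3 : (3 : ℕ∞) ≤ ((r + 3 : ℕ) : ℕ∞) := by exact_mod_cast (by omega : 3 ≤ r + 3)
    refine le_trans ?_ h3
    by_cases hC : ∀ C ∈ 𝒞, x ∈ C ↔ y ∈ C
    · exact (hone (Or.inr ⟨hxy.ne, Or.inl ⟨hxy, hC⟩⟩)).trans (by norm_num)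
    · push Not at hC
      obtain ⟨C, hC, ⟨hx, hy⟩ | ⟨hx, hy⟩⟩ := hC
      · exact cross hC hx hy hxy
      · rw [SimpleGraph.edist_comm]
        exact cross hC hy hx hxy.symm

end Parts

/-! ### Borel measurability -/

section Measurability

variable {X : Type*} {G : SimpleGraph X} {𝒞 : Set (Set X)}

/-- The enumerations by `n`-tuples of the edge boundaries of the members of `𝒞`. -/
def boundaryTuples (G : SimpleGraph X) (𝒞 : Set (Set X)) (n : ℕ) : Set (Fin n → X × X) :=
  {t | ∃ C ∈ 𝒞, Set.range t = outerEdgeBoundary G C}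

/-- The entry `p` determines the member, so every entry lies in one fixed set of at most `n` edges,
leaving at most `n ^ n` tuples. -/
theorem encard_boundaryTuples_le
    (hsep : ∀ x y : X, G.Adj x y → {C | C ∈ 𝒞 ∧ x ∈ C ∧ y ∉ C}.encard ≤ 1)
    {n : ℕ} (i : Fin n) (p : X × X) :
    {t | t ∈ boundaryTuples G 𝒞 n ∧ t i = p}.encard ≤ (n ^ n : ℕ) := by
  classical
  rcases Set.eq_empty_or_nonempty {t | t ∈ boundaryTuples G 𝒞 n ∧ t i = p} with h | ⟨t, ht, hti⟩
  · simp [h]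
  have hsub : {t | t ∈ boundaryTuples G 𝒞 n ∧ t i = p} ⊆
      ↑(Fintype.piFinset fun _ : Fin n => Finset.univ.image t) := by
    rintro s ⟨⟨D, hD, hs⟩, hsi⟩
    obtain ⟨C, hC, ht⟩ := ht
    have hpC : p ∈ outerEdgeBoundary G C := ht ▸ ⟨i, hti⟩
    have hpD : p ∈ outerEdgeBoundary G D := hs ▸ ⟨i, hsi⟩
    have hCD : C = D := eq_of_separates hsep hpC.2.2 hC hD hpC.1 hpC.2.1 hpD.1 hpD.2.1
    subst hCD
    have hst : Set.range s = Set.range t := hs.trans ht.symm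
    simp only [Finset.mem_coe, Fintype.mem_piFinset, Finset.mem_image, Finset.mem_univ, true_and]
    intro j
    have : s j ∈ Set.range t := hst ▸ ⟨j, rfl⟩
    exact this
  refine (Set.encard_le_encard hsub).trans ?_
  rw [Set.encard_coe_eq_coe_finsetCard, Fintype.card_piFinset_const]
  have hcard : (Finset.univ.image t).card ≤ n := by
    simpa using Finset.card_image_le (s := Finset.univ) (f := t)
  exact_mod_cast Nat.pow_le_pow_left hcard n

variable [MeasurableSpace X]

theorem measurableSet_boundaryTuples (h𝒞 : IsBorelTreeset G 𝒞) (n : ℕ) :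
    MeasurableSet (boundaryTuples G 𝒞 n) := by
  classical
  have hmk : Measurable (Sigma.mk (β := fun n : ℕ => Fin n → X × X) n) :=
    fun _ hs => MeasurableSpace.measurableSet_iInf.1 hs n
  have h := hmk h𝒞.measurable
  convert h using 1
  ext t
  simp [boundaryTuples]

theorem exists_boundaryTuples (h𝒞 : IsBorelTreeset G 𝒞) {C : Set X} (hC : C ∈ 𝒞) :
    ∃ n, ∃ t : Fin n → X × X, Set.range t = outerEdgeBoundary G C := by
  obtain ⟨-, -, -, -, hfin⟩ := h𝒞.isCut C hC
  obtain ⟨n, t, -, ht⟩ := hfin.fin_param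
  exact ⟨n, t, ht⟩

variable [StandardBorelSpace X]

/-- Images of Borel sets of boundary enumerations under maps that determine one entry. -/
theorem measurableSet_image_boundaryTuples {Y : Type*} [MeasurableSpace Y] [StandardBorelSpace Y]
    (hsep : ∀ x y : X, G.Adj x y → {C | C ∈ 𝒞 ∧ x ∈ C ∧ y ∉ C}.encard ≤ 1)
    {n : ℕ} {A : Set (Fin n → X × X)} (hA : MeasurableSet A) (hA' : A ⊆ boundaryTuples G 𝒞 n)
    (i : Fin n) {f : (Fin n → X × X) → Y} (hf : Measurable f) {g : Y → X × X}
    (hg : ∀ t, g (f t) = t i) : MeasurableSet (f '' A) := by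
  refine measurableSet_image_of_encard_fiber_le hf (n ^ n) A hA fun y =>
    (Set.encard_le_encard ?_).trans (encard_boundaryTuples_le hsep i (g y))
  rintro t ⟨ht, rfl⟩
  exact ⟨hA' ht, (hg t).symm⟩

theorem treePart_isBorel (h𝒞 : IsBorelTreeset G 𝒞)
    (hsep : ∀ x y : X, G.Adj x y → {C | C ∈ 𝒞 ∧ x ∈ C ∧ y ∉ C}.encard ≤ 1) :
    IsBorel (treePart h𝒞) := by
  let A : ∀ n, Fin n → Set (Fin n → X × X) := fun n i =>
    {t | t ∈ boundaryTuples G 𝒞 n ∧ ∀ j, pairKey (t i) ≤ pairKey (t j)}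
  have hA : ∀ n i, MeasurableSet (A n i) := by
    intro n i
    have h : MeasurableSet {t : Fin n → X × X | ∀ j, pairKey (t i) ≤ pairKey (t j)} := by
      rw [Set.ofPred_forall]
      exact MeasurableSet.iInter fun j => measurableSet_le
        (measurable_pairKey.comp (measurable_pi_apply i))
        (measurable_pairKey.comp (measurable_pi_apply j))
    exact (measurableSet_boundaryTuples h𝒞 n).inter h
  have heq : {p : X × X | (treePart h𝒞).Adj p.1 p.2} =
      ⋃ n, ⋃ i : Fin n, (fun t : Fin n → X × X => t i) '' A n i := by
    ext p
    simp only [Set.mem_iUnion, Set.mem_image]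
    constructor
    · rintro ⟨C, hC, hp, hmin⟩
      obtain ⟨n, t, ht⟩ := exists_boundaryTuples h𝒞 hC
      obtain ⟨i, hi⟩ : p ∈ Set.range t := ht ▸ hp
      refine ⟨n, i, t, ⟨⟨C, hC, ht⟩, fun j => ?_⟩, hi⟩
      rw [hi]
      exact hmin (t j) (ht ▸ ⟨j, rfl⟩)
    · rintro ⟨n, i, t, ⟨⟨C, hC, ht⟩, hmin⟩, rfl⟩
      refine ⟨C, hC, ht ▸ ⟨i, rfl⟩, fun q hq => ?_⟩
      rw [← ht] at hq
      obtain ⟨j, rfl⟩ := hq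
      exact hmin j
  unfold IsBorel
  rw [heq]
  exact MeasurableSet.iUnion fun n => MeasurableSet.iUnion fun i =>
    measurableSet_image_boundaryTuples hsep (hA n i) (fun _ h => h.1) i (measurable_pi_apply i)
      (g := id) fun _ => rfl

/-- Projecting this set to initial vertices gives the clique pairs of `blockPart`; its diagonal
gives the crossed edges. -/
theorem measurableSet_common_outerEdgeBoundary (h𝒞 : IsBorelTreeset G 𝒞)
    (hsep : ∀ x y : X, G.Adj x y → {C | C ∈ 𝒞 ∧ x ∈ C ∧ y ∉ C}.encard ≤ 1) :
    MeasurableSet {q : (X × X) × (X × X) | ∃ C ∈ 𝒞, q.1 ∈ outerEdgeBoundary G C ∧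
      q.2 ∈ outerEdgeBoundary G C} := by
  have heq : {q : (X × X) × (X × X) | ∃ C ∈ 𝒞, q.1 ∈ outerEdgeBoundary G C ∧
      q.2 ∈ outerEdgeBoundary G C} =
      ⋃ n, ⋃ i : Fin n, ⋃ j : Fin n,
        (fun t : Fin n → X × X => (t i, t j)) '' boundaryTuples G 𝒞 n := by
    ext ⟨p, q⟩
    simp only [Set.mem_iUnion, Set.mem_image]
    constructor
    · rintro ⟨C, hC, hp, hq⟩
      obtain ⟨n, t, ht⟩ := exists_boundaryTuples h𝒞 hC
      simp only [← ht] at hp hq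
      obtain ⟨i, rfl⟩ := hp
      obtain ⟨j, rfl⟩ := hq
      exact ⟨n, i, j, t, ⟨C, hC, ht⟩, rfl⟩
    · rintro ⟨n, i, j, t, ⟨C, hC, ht⟩, h⟩
      obtain ⟨rfl, rfl⟩ := Prod.mk.inj h
      exact ⟨C, hC, ht ▸ ⟨i, rfl⟩, ht ▸ ⟨j, rfl⟩⟩
  rw [heq]
  exact MeasurableSet.iUnion fun n => MeasurableSet.iUnion fun i => MeasurableSet.iUnion fun j =>
    measurableSet_image_boundaryTuples hsep (measurableSet_boundaryTuples h𝒞 n) subset_rfl i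
      ((measurable_pi_apply i).prodMk (measurable_pi_apply j)) (g := Prod.fst) fun _ => rfl

theorem blockPart_isBorel (hG : IsBorel G) (hdeg : HasBoundedDegrees G)
    (h𝒞 : IsBorelTreeset G 𝒞)
    (hsep : ∀ x y : X, G.Adj x y → {C | C ∈ 𝒞 ∧ x ∈ C ∧ y ∉ C}.encard ≤ 1) :
    IsBorel (blockPart G 𝒞) := by
  have hQ := measurableSet_common_outerEdgeBoundary h𝒞 hsep
  set Q := {q : (X × X) × (X × X) | ∃ C ∈ 𝒞, q.1 ∈ outerEdgeBoundary G C ∧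
    q.2 ∈ outerEdgeBoundary G C}
  obtain ⟨d, hd⟩ := hdeg
  let f : (X × X) × (X × X) → X × X := fun q => (q.1.1, q.2.1)
  have hf : Measurable f := by fun_prop
  have hfQ : MeasurableSet (f '' Q) := by
    -- A point of the fibre is given by the two outer endpoints, each a neighbour of a fixed vertex:
    -- at most `d` choices each.
    refine measurableSet_image_of_encard_fiber_le hf (d * d) Q hQ fun p => ?_
    have hsub : {q | q ∈ Q ∧ f q = p} ⊆ (fun y : X × X => ((p.1, y.1), (p.2, y.2))) ''
        ({y | G.Adj p.1 y} ×ˢ {y | G.Adj p.2 y}) := by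
      rintro ⟨⟨x, y⟩, ⟨x', y'⟩⟩ ⟨⟨C, hC, h1, h2⟩, rfl⟩
      exact ⟨(y, y'), ⟨h1.2.2, h2.2.2⟩, rfl⟩
    refine (Set.encard_le_encard hsub).trans ((Set.encard_image_le _ _).trans ?_)
    rw [Set.encard_prod, Nat.cast_mul]
    exact mul_le_mul' (hd _) (hd _)
  have hS : MeasurableSet {p : X × X | ∃ C ∈ 𝒞, p ∈ outerEdgeBoundary G C} := by
    have hdiag : Measurable fun p : X × X => (p, p) := by fun_prop
    simpa [Q, Set.preimage] using hdiag hQ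
  set S := {p : X × X | ∃ C ∈ 𝒞, p ∈ outerEdgeBoundary G C}
  have heq : {p : X × X | (blockPart G 𝒞).Adj p.1 p.2} =
      {p : X × X | p.1 = p.2}ᶜ ∩
        (({p : X × X | G.Adj p.1 p.2} \ (S ∪ Prod.swap ⁻¹' S)) ∪ f '' Q) := by
    ext ⟨x, y⟩
    refine and_congr Iff.rfl (or_congr (and_congr_right fun hxy => ?_) ?_)
    · constructor
      · rintro h (⟨C, hC, hx, hy, -⟩ | ⟨C, hC, hy, hx, -⟩)
        · exact hy ((h C hC).1 hx)
        · exact hx ((h C hC).2 hy)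
      · intro h C hC
        by_contra hne
        rw [Set.mem_union, not_or] at h
        by_cases hx : x ∈ C
        · exact h.1 ⟨C, hC, hx, fun hy => hne ⟨fun _ => hy, fun _ => hx⟩, hxy⟩
        · exact h.2 ⟨C, hC, by
            by_contra hy
            exact hne ⟨fun h => absurd h hx, fun h => absurd h hy⟩, hx, hxy.symm⟩
    · constructor
      · rintro ⟨C, hC, ⟨hx, u, hu, hxu⟩, ⟨hy, v, hv, hyv⟩⟩
        exact ⟨((x, u), (y, v)), ⟨C, hC, ⟨hx, hu, hxu⟩, ⟨hy, hv, hyv⟩⟩, rfl⟩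
      · rintro ⟨⟨⟨a, u⟩, ⟨b, v⟩⟩, ⟨C, hC, ⟨hx, hu, hxu⟩, ⟨hy, hv, hyv⟩⟩, h⟩
        obtain ⟨rfl, rfl⟩ := Prod.mk.inj h
        exact ⟨C, hC, ⟨hx, u, hu, hxu⟩, ⟨hy, v, hv, hyv⟩⟩
  unfold IsBorel
  rw [heq]
  exact (measurableSet_eq_fun measurable_fst measurable_snd).compl.inter
    ((hG.diff (hS.union (measurable_swap hS))).union hfQ)

end Measurability

end BorelGraph

theorem proposition2p15 {X : Type*} [MeasurableSpace X] [StandardBorelSpace X]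
    (G : SimpleGraph X) (hG : BorelGraph.IsBorel G) (hdeg : BorelGraph.HasBoundedDegrees G)
    (𝒞 : Set (Set X)) (h𝒞 : BorelGraph.IsBorelTreeset G 𝒞)
    (hbdd : BorelGraph.HasUniformlyBoundedBoundaries G 𝒞)
    (hsep : ∀ x y : X, G.Adj x y → {C | C ∈ 𝒞 ∧ x ∈ C ∧ y ∉ C}.encard ≤ 1) :
    ∃ G' : SimpleGraph X, BorelGraph.IsBorel G' ∧ BorelGraph.LipschitzEquivalent G G' ∧
      ∃ T H : SimpleGraph X, BorelGraph.IsBorel T ∧ BorelGraph.IsBorel H ∧ T ≤ G' ∧ H ≤ G' ∧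
        BorelGraph.IsFreeProduct G' T H ∧
        T.IsAcyclic ∧
        BorelGraph.cutsIn H (BorelGraph.restrictFamily 𝒞 H) = ∅ := by
  have hT := BorelGraph.treePart_isBorel h𝒞 hsep
  have hH := BorelGraph.blockPart_isBorel hG hdeg h𝒞 hsep
  exact ⟨BorelGraph.treePart h𝒞 ⊔ BorelGraph.blockPart G 𝒞, hT.union hH,
    BorelGraph.lipschitzEquivalent_treePart_sup_blockPart h𝒞 hbdd,
    BorelGraph.treePart h𝒞, BorelGraph.blockPart G 𝒞, hT, hH, le_sup_left, le_sup_right,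
    ⟨rfl, BorelGraph.freelyIntersecting_treePart_blockPart h𝒞 hsep⟩,
    BorelGraph.treePart_isAcyclic h𝒞 hsep, BorelGraph.cutsIn_blockPart h𝒞 hsep⟩
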